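/- Let $M$ be a closed smooth manifold and let $\mathbb T^d\to E\xrightarrow{\pi}M$ be a smooth affine torus bundle, i.e. a locally trivial smooth fiber bundle with fiber $\mathbb T^d=\mathbb R^d/\mathbb Z^d$ and structure group $SL(d,\mathbb Z)\ltimes\mathbb T^d$ acting on $\mathbb T^d$ by $(A,v)y=Ay+v$. Let $\mathbb T^d_x=\pi^{-1}(x)$ and $VE=\ker D\pi\subset TE$, and fix continuous Riemannian metrics on $M$ and $E$. A $C^1$ flow $\psi^t$ on $X$ ($X=M$ or $X=E$) is *Anosov* if its generating vector field $Z$ vanishes nowhere and there is a splitting $TX=E^s\oplus\mathbb R Z\oplus E^u$ with $E^s,E^u$ continuous $D\psi^t$-invariant subbundles, and constants $C>0$, $\lambda\in(0,1)$ such that $\|D\psi^t v\|\le C\lambda^t\|v\|$ for $v\in E^s$, $t>0$, and $\|D\psi^{-t}v\|\le C\lambda^t\|v\|$ for $v\in E^u$, $t>0$. Let $\varphi^t:M\to M$ be an Anosov flow and let $\Phi^t:E\to E$ be a flow which fibers over it, $\pi\circ\Phi^t=\varphi^t\circ\pi$. Assume that $\Phi^t$ is Anosov as a flow on the total space $E$.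 Then $\Phi^t$ is a fiberwise Anosov flow over $\varphi^t$: there are continuous $D\Phi^t$-invariant subbundles $V^s,V^u$ of $TE$ with $VE=V^s\oplus V^u$ and constants $C>0$, $\lambda\in(0,1)$ such that for all $t>0$ $$\|D\Phi^t v\|\le C\lambda^t\|v\|\ (v\in V^s),\qquad \|D\Phi^{-t}v\|\le C\lambda^t\|v\|\ (v\in V^u).$$ Moreover, for every Anosov splitting $TE=E^s\oplus\mathbb R Z\oplus E^u$ of $\Phi^t$ one can take $V^s=E^s\cap\ker D\pi$ and $V^u=E^u\cap\ker D\pi$. If in addition $\Phi^t$ is fiberwise affine, i.e. for all $t\in\mathbb R$ and $x\in M$ the map $\Phi^t:\mathbb T^d_x\to\mathbb T^d_{\varphi^t(x)}$ is an affine diffeomorphism ($y\mapsto Ay+v$ with $A\in GL(d,\mathbb Z)$ in bundle charts), then $\Phi^t$ is a fiberwise affine Anosov flow, i.e. both fiberwise Anosov and fiberwise affine. -/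

import Mathlib

open Set Filter Topology Bundle
open scoped Manifold ContDiff

noncomputable section

/-! ### Flows and their derivatives -/

section Flows

variable (n : ℕ) {X : Type*} [TopologicalSpace X] [ChartedSpace (EuclideanSpace ℝ (Fin n)) X]

/-- A flow of class `C^1`: the map `(t, x) ↦ φ^t(x)` is `C^1` on `ℝ × X`. -/
def IsC1Flow (φ : Flow ℝ X) : Prop :=
  ContMDiff (𝓘(ℝ, ℝ).prod (𝓡 n)) (𝓡 n) 1 (fun p : ℝ × X => φ p.1 p.2)

/-- The derivative `Dφ^t` at `x` of the time-`t` map of a flow. -/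
def flowDeriv (φ : Flow ℝ X) (t : ℝ) (x : X) :
    TangentSpace (𝓡 n) x →L[ℝ] TangentSpace (𝓡 n) (φ t x) :=
  mfderiv (𝓡 n) (𝓡 n) (fun y => φ t y) x

/-- The generating vector field of a flow: the velocity at time `0` of the orbit of `x`
(recall that `φ 0 x = x`). -/
def flowGenerator (φ : Flow ℝ X) (x : X) : TangentSpace (𝓡 n) x :=
  mfderiv 𝓘(ℝ, ℝ) (𝓡 n) (fun t : ℝ => φ t x) 0 (1 : ℝ)

variable {n} [IsManifold (𝓡 n) ∞ X]

/-- A family of subspaces `S x ⊆ T_x X` is a continuous subbundle of the tangent bundle if near each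
point it is spanned by finitely many continuous, linearly independent vector fields. -/
def IsContinuousSubbundle (S : ∀ x : X, Submodule ℝ (TangentSpace (𝓡 n) x)) : Prop :=
  ∀ x₀ : X, ∃ (k : ℕ) (U : Set X) (v : Fin k → ∀ x : X, TangentSpace (𝓡 n) x),
    IsOpen U ∧ x₀ ∈ U ∧
    (∀ i, ContinuousOn (fun x => (⟨x, v i x⟩ : TangentBundle (𝓡 n) X)) U) ∧
    ∀ x ∈ U, LinearIndependent ℝ (fun i => v i x) ∧
      S x = Submodule.span ℝ (Set.range fun i => v i x)

/-- Invariance under the flow: `Dφ^t (S x) = S (φ^t x)` for all `t` and `x`. -/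
def IsFlowInvariant (φ : Flow ℝ X) (S : ∀ x : X, Submodule ℝ (TangentSpace (𝓡 n) x)) : Prop :=
  ∀ (t : ℝ) (x : X), (S x).map (flowDeriv n φ t x).toLinearMap = S (φ t x)

/-- The hyperbolicity estimates, with common constants `C > 0` and `lam ∈ (0, 1)`:
for all `t > 0`, `Dφ^t` contracts `S` and `Dφ^{-t}` contracts `U` by the factor `C * lam ^ t`. -/
def IsHyperbolicPair [RiemannianBundle (fun x : X => TangentSpace (𝓡 n) x)]
    (φ : Flow ℝ X) (S U : ∀ x : X, Submodule ℝ (TangentSpace (𝓡 n) x)) : Prop :=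
  ∃ C lam : ℝ, 0 < C ∧ 0 < lam ∧ lam < 1 ∧ ∀ (t : ℝ), 0 < t → ∀ x : X,
    (∀ v ∈ S x, ‖flowDeriv n φ t x v‖ ≤ C * lam ^ t * ‖v‖) ∧
    (∀ v ∈ U x, ‖flowDeriv n φ (-t) x v‖ ≤ C * lam ^ t * ‖v‖)

/-- `TX = S ⊕ ℝ·Z ⊕ U`, where `Z` is the nowhere vanishing generator of the flow, is an
Anosov splitting: `S` and `U` are continuous invariant subbundles, with `S` uniformly contracted in
forward time and `U` uniformly contracted in backward time. -/
structure IsAnosovSplitting [RiemannianBundle (fun x : X => TangentSpace (𝓡 n) x)]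
    (φ : Flow ℝ X) (S U : ∀ x : X, Submodule ℝ (TangentSpace (𝓡 n) x)) : Prop where
  continuous_stable : IsContinuousSubbundle S
  continuous_unstable : IsContinuousSubbundle U
  generator_ne_zero : ∀ x, flowGenerator n φ x ≠ 0
  independent : ∀ x, iSupIndep ![S x, Submodule.span ℝ {flowGenerator n φ x}, U x]
  sup_eq_top : ∀ x, S x ⊔ Submodule.span ℝ {flowGenerator n φ x} ⊔ U x = ⊤
  invariant_stable : IsFlowInvariant φ S
  invariant_unstable : IsFlowInvariant φ U
  hyperbolic : IsHyperbolicPair φ S U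

variable (n) in
/-- An Anosov flow (with respect to the given Riemannian metric; on a closed manifold the notion
does not depend on the metric). -/
def IsAnosovFlow [RiemannianBundle (fun x : X => TangentSpace (𝓡 n) x)] (φ : Flow ℝ X) : Prop :=
  IsC1Flow n φ ∧ ∃ S U : ∀ x : X, Submodule ℝ (TangentSpace (𝓡 n) x), IsAnosovSplitting φ S U

end Flows

/-! ### Affine torus bundles -/

/-- The torus `𝕋^d = (ℝ/ℤ)^d`. -/
abbrev Torus (d : ℕ) : Type := Fin d → UnitAddCircle

/-- The affine map `y ↦ A y + v` of the torus. -/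
def torusAffine {d : ℕ} (A : Matrix (Fin d) (Fin d) ℤ) (v y : Torus d) : Torus d :=
  fun i => (∑ j, A i j • y j) + v i

/-- A smooth affine `𝕋^d`-bundle `proj : E → M`: a fiber bundle with structure group
`SL(d, ℤ) ⋉ 𝕋^d`, given by an atlas of local trivializations.

* `smooth`: each trivialization is a diffeomorphism `proj⁻¹(baseSet) ≅ baseSet × 𝕋^d`. As `𝕋^d` has
  the smooth structure for which `ℝ^d → 𝕋^d` is a local diffeomorphism, this says that
  the composition `baseSet × ℝ^d → baseSet × 𝕋^d → E` is a smooth local diffeomorphism.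
* `transition`: over every point the coordinate changes are given by elements
  of `SL(d, ℤ) ⋉ 𝕋^d`. (Since coordinate changes are smooth and the group acts effectively, the
  element then depends smoothly on the point.) -/
structure AffineTorusBundle (m n d : ℕ) (M E : Type*)
    [TopologicalSpace M] [ChartedSpace (EuclideanSpace ℝ (Fin m)) M]
    [TopologicalSpace E] [ChartedSpace (EuclideanSpace ℝ (Fin n)) E] where
  proj : E → M
  atlas : Set (Trivialization (Torus d) proj)
  cover : ∀ x : M, ∃ e ∈ atlas, x ∈ e.baseSet
  smooth : ∀ e ∈ atlas,
    IsLocalDiffeomorphOn ((𝓡 m).prod (𝓡 d)) (𝓡 n) ∞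
      (fun q : M × EuclideanSpace ℝ (Fin d) =>
        e.toOpenPartialHomeomorph.symm (q.1, fun i => ((q.2 i : ℝ) : UnitAddCircle)))
      (e.baseSet ×ˢ univ)
  transition : ∀ e ∈ atlas, ∀ e' ∈ atlas, ∀ x ∈ e.baseSet ∩ e'.baseSet,
    ∃ (A : Matrix.SpecialLinearGroup (Fin d) ℤ) (v : Torus d),
      ∀ p : E, proj p = x → (e' p).2 = torusAffine (A : Matrix (Fin d) (Fin d) ℤ) v (e p).2

namespace AffineTorusBundle

variable {m n d : ℕ} {M E : Type*}
  [TopologicalSpace M] [ChartedSpace (EuclideanSpace ℝ (Fin m)) M]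
  [TopologicalSpace E] [ChartedSpace (EuclideanSpace ℝ (Fin n)) E]

/-- The vertical subbundle `VE = ker Dπ`. -/
def vertical (B : AffineTorusBundle m n d M E) (p : E) : Submodule ℝ (TangentSpace (𝓡 n) p) :=
  LinearMap.ker (mfderiv (𝓡 n) (𝓡 m) B.proj p).toLinearMap

/-- `Φ^t` fibers over `φ^t`: `π ∘ Φ^t = φ^t ∘ π`. -/
def FibersOver (B : AffineTorusBundle m n d M E) (Φ : Flow ℝ E) (φ : Flow ℝ M) : Prop :=
  ∀ (t : ℝ) (p : E), B.proj (Φ t p) = φ t (B.proj p)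

/-- For all `t` and `x` the map `Φ^t : 𝕋_x^d → 𝕋_{φ^t(x)}^d` is an affine diffeomorphism, that is,
it has the form `y ↦ A y + v` with `A ∈ GL(d, ℤ)` in trivializations of the atlas. -/
def IsFiberwiseAffine (B : AffineTorusBundle m n d M E) (Φ : Flow ℝ E) (φ : Flow ℝ M) : Prop :=
  ∀ (t : ℝ) (x : M), ∀ e ∈ B.atlas, ∀ e' ∈ B.atlas, x ∈ e.baseSet → φ t x ∈ e'.baseSet →
    ∃ (A : Matrix.GeneralLinearGroup (Fin d) ℤ) (v : Torus d),
      ∀ p : E, B.proj p = x →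
        (e' (Φ t p)).2 = torusAffine (A : Matrix (Fin d) (Fin d) ℤ) v (e p).2

/-- `VE = Vs ⊕ Vu` is a fiberwise Anosov splitting: `Vs` and `Vu` are continuous invariant
subbundles, uniformly contracted in forward and in backward time, respectively. -/
structure IsFiberwiseAnosovSplitting [IsManifold (𝓡 n) ∞ E]
    [RiemannianBundle (fun p : E => TangentSpace (𝓡 n) p)]
    (B : AffineTorusBundle m n d M E) (Φ : Flow ℝ E)
    (Vs Vu : ∀ p : E, Submodule ℝ (TangentSpace (𝓡 n) p)) : Prop where
  continuous_stable : IsContinuousSubbundle Vs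
  continuous_unstable : IsContinuousSubbundle Vu
  disjoint : ∀ p, Disjoint (Vs p) (Vu p)
  sup_eq_vertical : ∀ p, Vs p ⊔ Vu p = B.vertical p
  invariant_stable : IsFlowInvariant Φ Vs
  invariant_unstable : IsFlowInvariant Φ Vu
  hyperbolic : IsHyperbolicPair Φ Vs Vu

/-- A fiberwise Anosov flow `Φ` over `φ`. -/
def IsFiberwiseAnosovFlow [IsManifold (𝓡 n) ∞ E]
    [RiemannianBundle (fun p : E => TangentSpace (𝓡 n) p)]
    (B : AffineTorusBundle m n d M E) (Φ : Flow ℝ E) (φ : Flow ℝ M) : Prop :=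
  IsC1Flow n Φ ∧ B.FibersOver Φ φ ∧
    ∃ Vs Vu : ∀ p : E, Submodule ℝ (TangentSpace (𝓡 n) p), B.IsFiberwiseAnosovSplitting Φ Vs Vu

/-- A fiberwise affine Anosov flow `Φ` over `φ`. -/
def IsFiberwiseAffineAnosovFlow [IsManifold (𝓡 n) ∞ E]
    [RiemannianBundle (fun p : E => TangentSpace (𝓡 n) p)]
    (B : AffineTorusBundle m n d M E) (Φ : Flow ℝ E) (φ : Flow ℝ M) : Prop :=
  B.IsFiberwiseAnosovFlow Φ φ ∧ B.IsFiberwiseAffine Φ φ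

end AffineTorusBundle

end

/-!
Let `TM = S ⊕ ℝZ ⊕ U` and `TE = Es ⊕ ℝZ ⊕ Eu` be Anosov splittings of `φ` and `Φ`. The heart of the
proof is that `VE = ker Dπ` splits into its intersections with `Es` and `Eu`
(`AffineTorusBundle.vertical_le_sup`). Write a vertical vector as `v = a + bZ + c`, so that
`0 = Dπ a + bZ + Dπ c`. The total space is compact, hence `Dπ` is bounded
(`AffineTorusBundle.compactSpace`, `ContMDiff.exists_norm_mfderiv_le`); as `Dπ` intertwines the
flows, `Dφ^t (Dπ a)` tends to zero in forward time and `Dφ^t (Dπ c)` in backward time. On a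
compact manifold this forces `Dπ a ∈ S` and `Dπ c ∈ U`
(`IsAnosovSplitting.mem_stable_of_tendsto`, `IsAnosovSplitting.mem_unstable_of_tendsto`): an unstable
component of `Dπ a` would grow without bound, and a component along the generator would stay bounded
away from zero. By independence of the splitting of `TM` all three terms vanish, so `b = 0`, and
`a` and `c` are vertical.

Invariance and the hyperbolicity estimates for `Es ∩ VE` and `Eu ∩ VE` are inherited. Their
continuity (`IsContinuousSubbundle.inf_ker_mfderiv`) is shown with projections: `π` is a submersion,
so there are continuous local projections `Q` onto `VE`, and the splitting of `TE` gives continuous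
projections `P` onto `Es` or `Eu`. Since `VE` splits, `P ∘ Q` is a projection onto the intersection,
and the images of a continuous family of projections have continuous local frames
(`exists_frame_of_isProj`).
-/

noncomputable section

/-! ### Local frames and continuous families of projections -/

section LocalFrames

variable {X : Type*} [TopologicalSpace X]
  {F : Type*} [NormedAddCommGroup F] [NormedSpace ℝ F]
  {G : Type*} [NormedAddCommGroup G] [NormedSpace ℝ G] [FiniteDimensional ℝ G]

/-- The images of a continuous family of projections `T x` have continuous local frames. The
vectors `T x b` and `c - T x c`, for bases `b` of the image and `c` of the kernel of `T x₀`, form a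
basis for `x = x₀`, hence also nearby; in particular the rank of `T` is locally constant. -/
theorem exists_frame_of_isProj [FiniteDimensional ℝ F] {U : Set X} (hU : IsOpen U) {x₀ : X}
    (hx₀ : x₀ ∈ U)
    {S : X → Submodule ℝ F} {T : X → F →L[ℝ] F} (hT : ContinuousOn T U)
    (hS : ∀ x ∈ U, LinearMap.IsProj (S x) (T x)) :
    ∃ (k : ℕ) (W : Set X) (w : Fin k → X → F), IsOpen W ∧ x₀ ∈ W ∧ W ⊆ U ∧
      (∀ i, ContinuousOn (w i) W) ∧
      ∀ x ∈ W, LinearIndependent ℝ (fun i => w i x) ∧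
        S x = Submodule.span ℝ (range fun i => w i x) := by
  have hcompl := LinearMap.IsProj.isCompl (f := (T x₀ : F →ₗ[ℝ] F))
    ⟨(hS x₀ hx₀).map_mem, (hS x₀ hx₀).map_id⟩
  set K : Submodule ℝ F := LinearMap.ker (T x₀ : F →ₗ[ℝ] F) with hK
  let b := Module.finBasis ℝ (S x₀)
  let c := Module.finBasis ℝ K
  let g : X → Fin (Module.finrank ℝ (S x₀)) ⊕ Fin (Module.finrank ℝ K) → F :=
    fun x => Sum.elim (fun i => T x (b i)) (fun j => c j - T x (c j))
  have hg0 : g x₀ = Sum.elim (fun i => (b i : F)) (fun j => (c j : F)) := by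
    ext (i | j)
    · exact (hS x₀ hx₀).map_id _ (b i).2
    · simp [g]
  have hli : LinearIndependent ℝ (g x₀) := by
    rw [hg0]
    refine LinearIndependent.sum_type (b.linearIndependent.map' (S x₀).subtype (by simp))
      (c.linearIndependent.map' K.subtype (by simp)) (hcompl.disjoint.mono ?_ ?_)
    · exact Submodule.span_le.2 (by rintro _ ⟨i, rfl⟩; exact (b i).2)
    · exact Submodule.span_le.2 (by rintro _ ⟨i, rfl⟩; exact (c i).2)
  have hgc : ContinuousOn g U := by
    refine continuousOn_pi.2 ?_
    rintro (i | j)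
    · exact hT.clm_apply continuousOn_const
    · exact continuousOn_const.sub (hT.clm_apply continuousOn_const)
  refine ⟨_, U ∩ g ⁻¹' {f | LinearIndependent ℝ f}, fun i x => T x (b i),
    hgc.isOpen_inter_preimage hU isOpen_setOfPred_linearIndependent, ⟨hx₀, hli⟩, inter_subset_left,
    fun i => (hT.clm_apply continuousOn_const).mono inter_subset_left, ?_⟩
  rintro x ⟨hxU, hx⟩
  have hx : LinearIndependent ℝ (g x) := hx
  refine ⟨hx.comp Sum.inl Sum.inl_injective, le_antisymm ?_ ?_⟩
  · have htop : Submodule.span ℝ (range (g x)) = ⊤ := by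
      refine hx.span_eq_top_of_card_eq_finrank' ?_
      simp [Submodule.finrank_add_eq_of_isCompl hcompl]
    intro w hw
    have hmem : T x w ∈ (Submodule.span ℝ (range (g x))).map (T x : F →ₗ[ℝ] F) :=
      Submodule.mem_map_of_mem (by rw [htop]; trivial)
    rw [(hS x hxU).map_id w hw, Submodule.map_span] at hmem
    refine Submodule.span_le.2 ?_ hmem
    rintro _ ⟨_, ⟨i | j, rfl⟩, rfl⟩
    · refine Submodule.subset_span ⟨i, ?_⟩
      exact ((hS x hxU).map_id _ ((hS x hxU).map_mem _)).symm
    · have : T x (g x (Sum.inr j)) = 0 := by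
        have h := (hS x hxU).map_id _ ((hS x hxU).map_mem (c j))
        simp [g, h]
      simp [this]
  · refine Submodule.span_le.2 ?_
    rintro _ ⟨i, rfl⟩
    exact (hS x hxU).map_mem _

/-- If two continuous families of vectors together form a basis at every point, then the projection
onto the span of the first along the span of the second is continuous. -/
theorem exists_continuousOn_projection {U : Set X} {ι κ : Type*} [Fintype ι] [Fintype κ]
    {v : ι → X → F} {w : κ → X → F}
    (hv : ∀ i, ContinuousOn (v i) U) (hw : ∀ j, ContinuousOn (w j) U)
    (hli : ∀ x ∈ U, LinearIndependent ℝ (Sum.elim (fun i => v i x) (fun j => w j x)))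
    (hspan : ∀ x ∈ U, Submodule.span ℝ (range fun i => v i x) ⊔
      Submodule.span ℝ (range fun j => w j x) = ⊤) :
    ∃ P : X → F →L[ℝ] F, ContinuousOn P U ∧ ∀ x ∈ U,
      (∀ a ∈ Submodule.span ℝ (range fun i => v i x), P x a = a) ∧
      ∀ a ∈ Submodule.span ℝ (range fun j => w j x), P x a = 0 := by
  let L : X → (ι ⊕ κ → ℝ) →L[ℝ] F := fun x =>
    (∑ i, (ContinuousLinearMap.proj (R := ℝ) (φ := fun _ : ι ⊕ κ => ℝ) (Sum.inl i)).smulRight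
      (v i x)) +
    ∑ j, (ContinuousLinearMap.proj (R := ℝ) (φ := fun _ : ι ⊕ κ => ℝ) (Sum.inr j)).smulRight
      (w j x)
  let Lv : X → (ι ⊕ κ → ℝ) →L[ℝ] F := fun x =>
    ∑ i, (ContinuousLinearMap.proj (R := ℝ) (φ := fun _ : ι ⊕ κ => ℝ) (Sum.inl i)).smulRight
      (v i x)
  have hsr : ∀ (c : (ι ⊕ κ → ℝ) →L[ℝ] ℝ) (u : X → F), ContinuousOn u U →
      ContinuousOn (fun x => c.smulRight (u x)) U := fun c u hu =>
    ((ContinuousLinearMap.smulRightL ℝ (ι ⊕ κ → ℝ) F) c).continuous.comp_continuousOn hu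
  have hLv : ContinuousOn Lv U := continuousOn_finsetSum _ fun i _ => hsr _ _ (hv i)
  have hL : ContinuousOn L U := hLv.add (continuousOn_finsetSum _ fun j _ => hsr _ _ (hw j))
  have hLe : ∀ x c, L x c = Fintype.linearCombination ℝ
      (Sum.elim (fun i => v i x) (fun j => w j x)) c := by
    intro x c
    simp [L, Fintype.linearCombination_apply]
  have hinv : ∀ x ∈ U, ∃ e : (ι ⊕ κ → ℝ) ≃L[ℝ] F, (e : (ι ⊕ κ → ℝ) →L[ℝ] F) = L x := by
    intro x hx
    have hbij : Function.Bijective (L x : (ι ⊕ κ → ℝ) →ₗ[ℝ] F) := by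
      have : (L x : (ι ⊕ κ → ℝ) →ₗ[ℝ] F) = Fintype.linearCombination ℝ
        (Sum.elim (fun i => v i x) (fun j => w j x)) := LinearMap.ext (hLe x)
      rw [this]
      constructor
      · exact LinearIndependent.fintypeLinearCombination_injective (hli x hx)
      · rw [← LinearMap.range_eq_top, Fintype.range_linearCombination, Sum.elim_range,
          Submodule.span_union]
        exact hspan x hx
    refine ⟨(LinearEquiv.ofBijective _ hbij).toContinuousLinearEquiv, ?_⟩
    ext1 c
    rfl
  refine ⟨fun x => (Lv x).comp (L x).inverse, ?_, ?_⟩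
  · refine hLv.clm_comp fun x hx => ?_
    obtain ⟨e, he⟩ := hinv x hx
    have h1 : ContinuousAt (ContinuousLinearMap.inverse : ((ι ⊕ κ → ℝ) →L[ℝ] F) → _) (L x) := by
      rw [← he]
      exact (contDiffAt_map_inverse (n := 0) e).continuousAt
    exact h1.comp_continuousWithinAt (hL x hx)
  · intro x hx
    obtain ⟨e, he⟩ := hinv x hx
    have key : ∀ c, ((Lv x).comp (L x).inverse) (L x c) = Lv x c := by
      intro c
      rw [← he]
      simp
    classical
    constructor
    · intro a ha
      refine LinearMap.eqOn_span (f := (((Lv x).comp (L x).inverse : F →L[ℝ] F) : F →ₗ[ℝ] F))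
        (g := LinearMap.id) ?_ ha
      rintro _ ⟨i, rfl⟩
      have h1 : L x (Pi.single (Sum.inl i) 1) = v i x := by rw [hLe]; simp
      have h2 : Lv x (Pi.single (Sum.inl i) 1) = v i x := by
        simp [Lv, Pi.single_apply]
      exact (congrArg _ h1).symm.trans ((key _).trans h2)
    · intro a ha
      refine LinearMap.eqOn_span (f := (((Lv x).comp (L x).inverse : F →L[ℝ] F) : F →ₗ[ℝ] F))
        (g := 0) ?_ ha
      rintro _ ⟨j, rfl⟩
      have h1 : L x (Pi.single (Sum.inr j) 1) = w j x := by rw [hLe]; simp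
      have h2 : Lv x (Pi.single (Sum.inr j) 1) = 0 := by
        simp [Lv]
      exact (congrArg _ h1).symm.trans ((key _).trans h2)

/-- Near a point where it is surjective, a continuous family of linear maps `A x` has a continuous
family of projections onto its kernels: if `R` is a right inverse of `A x₀`, then `A x ∘ R` is
invertible for `x` near `x₀`, and `1 - R (A x ∘ R)⁻¹ (A x)` projects onto `ker (A x)`. -/
theorem exists_isProj_ker {U : Set X} (hU : IsOpen U) {x₀ : X} (hx₀ : x₀ ∈ U)
    {A : X → F →L[ℝ] G} (hA : ContinuousOn A U) (hsurj : Function.Surjective (A x₀)) :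
    ∃ (W : Set X) (Q : X → F →L[ℝ] F), IsOpen W ∧ x₀ ∈ W ∧ W ⊆ U ∧ ContinuousOn Q W ∧
      ∀ x ∈ W, LinearMap.IsProj (LinearMap.ker (A x : F →ₗ[ℝ] G)) (Q x) := by
  obtain ⟨r, hr⟩ := LinearMap.exists_rightInverse_of_surjective (A x₀ : F →ₗ[ℝ] G)
    (LinearMap.range_eq_top.2 hsurj)
  let R : G →L[ℝ] F := LinearMap.toContinuousLinearMap r
  have hAR : ContinuousOn (fun x => (A x).comp R) U := hA.clm_comp continuousOn_const
  have hone : (A x₀).comp R = 1 := by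
    ext1 g
    exact LinearMap.congr_fun hr g
  have hWo : IsOpen (U ∩ (fun x => (A x).comp R) ⁻¹' {f : G →L[ℝ] G | IsUnit f}) :=
    hAR.isOpen_inter_preimage hU Units.isOpen
  refine ⟨_, fun x => 1 - (R.comp (Ring.inverse ((A x).comp R))).comp (A x), hWo,
    ⟨hx₀, ?_⟩, inter_subset_left, ?_, ?_⟩
  · change IsUnit ((A x₀).comp R)
    rw [hone]; exact isUnit_one
  · refine continuousOn_const.sub (ContinuousOn.clm_comp (continuousOn_const.clm_comp ?_)
      (hA.mono inter_subset_left))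
    rintro x ⟨hx, ⟨u, hu⟩⟩
    have h1 : ContinuousAt (Ring.inverse : (G →L[ℝ] G) → _) ((fun x => (A x).comp R) x) := by
      rw [← hu]; exact NormedRing.inverse_continuousAt u
    exact ContinuousAt.comp_continuousWithinAt (f := fun x => (A x).comp R) h1
      ((hAR x hx).mono inter_subset_left)
  · rintro x ⟨hx, hu⟩
    have hu : IsUnit ((A x).comp R) := hu
    have hm := Ring.mul_inverse_cancel _ hu
    constructor
    · intro a
      have := DFunLike.congr_fun hm (A x a)
      change A x (a - R (Ring.inverse ((A x).comp R) (A x a))) = 0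
      rw [map_sub, sub_eq_zero]
      exact this.symm
    · intro a ha
      have ha : A x a = 0 := ha
      simp [ha]

end LocalFrames

/-! ### Derivatives of `C^1` flows -/

section FlowCalculus

variable {n : ℕ} {X : Type*} [TopologicalSpace X] [ChartedSpace (EuclideanSpace ℝ (Fin n)) X]
  {φ : Flow ℝ X}

/-- All tangent spaces are the model space by definition, but their norms depend on the base point.
This transports the norm of a vector along an equality of base points. -/
theorem norm_tangent_congr [RiemannianBundle (fun x : X => TangentSpace (𝓡 n) x)]
    {x y : X} (h : x = y) (w : EuclideanSpace ℝ (Fin n)) :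
    ‖(show TangentSpace (𝓡 n) x from w)‖ = ‖(show TangentSpace (𝓡 n) y from w)‖ := by
  subst h; rfl

theorem IsC1Flow.contMDiff_map (hφ : IsC1Flow n φ) (t : ℝ) :
    ContMDiff (𝓡 n) (𝓡 n) 1 (fun x => φ t x) :=
  ContMDiff.comp (g := fun p : ℝ × X => φ p.1 p.2) hφ (contMDiff_const.prodMk contMDiff_id)

theorem IsC1Flow.mdifferentiable_map (hφ : IsC1Flow n φ) (t : ℝ) :
    MDifferentiable (𝓡 n) (𝓡 n) (fun x => φ t x) :=
  (hφ.contMDiff_map t).mdifferentiable one_ne_zero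

theorem IsC1Flow.mdifferentiable_orbit (hφ : IsC1Flow n φ) (x : X) :
    MDifferentiable 𝓘(ℝ, ℝ) (𝓡 n) (fun t => φ t x) :=
  (ContMDiff.comp (g := fun p : ℝ × X => φ p.1 p.2) hφ
    (contMDiff_id.prodMk contMDiff_const)).mdifferentiable one_ne_zero

/-- The generator of a flow is invariant under the flow. -/
theorem IsC1Flow.flowDeriv_flowGenerator (hφ : IsC1Flow n φ) (t : ℝ) (x : X) :
    flowDeriv n φ t x (flowGenerator n φ x) = flowGenerator n φ (φ t x) := by
  have h : (fun y => φ t y) ∘ (fun s => φ s x) = fun s => φ s (φ t x) := by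
    ext s
    simp only [Function.comp_apply, ← φ.map_add, add_comm]
  have h1 := mfderiv_comp_apply (0 : ℝ) (hφ.mdifferentiable_map t (φ 0 x))
    (hφ.mdifferentiable_orbit x 0) (1 : ℝ)
  rw [h] at h1
  refine Eq.trans ?_ h1.symm
  exact DFunLike.congr_fun (mfderiv_congr_point (I := 𝓡 n) (I' := 𝓡 n) (f := fun y => φ t y)
    (φ.map_zero_apply x).symm) (flowGenerator n φ x)

/-- The equality is stated in the model space, since the base points `φ (-t) (φ t x)` and `x` are
equal only propositionally. -/
theorem IsC1Flow.flowDeriv_neg_flowDeriv (hφ : IsC1Flow n φ) (t : ℝ) (x : X)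
    (v : TangentSpace (𝓡 n) x) :
    @Eq (EuclideanSpace ℝ (Fin n)) (flowDeriv n φ (-t) (φ t x) (flowDeriv n φ t x v)) v := by
  have h : (fun y => φ (-t) y) ∘ (fun y => φ t y) = id := by
    ext s
    simp [← φ.map_add]
  have h1 := mfderiv_comp_apply x (hφ.mdifferentiable_map (-t) (φ t x))
    (hφ.mdifferentiable_map t x) v
  rw [h] at h1
  refine Eq.trans h1.symm ?_
  rw [mfderiv_id]
  rfl

theorem IsC1Flow.norm_flowDeriv_neg_flowDeriv
    [RiemannianBundle (fun x : X => TangentSpace (𝓡 n) x)]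
    (hφ : IsC1Flow n φ) (t : ℝ) (x : X) (v : TangentSpace (𝓡 n) x) :
    ‖flowDeriv n φ (-t) (φ t x) (flowDeriv n φ t x v)‖ = ‖v‖ := by
  have h : φ (-t) (φ t x) = x := by simp [← φ.map_add]
  refine Eq.trans (norm_tangent_congr h _) ?_
  exact congrArg (fun w : TangentSpace (𝓡 n) x => ‖w‖) (hφ.flowDeriv_neg_flowDeriv t x v)

theorem IsC1Flow.continuous_flowGenerator [IsManifold (𝓡 n) ∞ X] (hφ : IsC1Flow n φ) :
    Continuous (fun x => (⟨x, flowGenerator n φ x⟩ : TangentBundle (𝓡 n) X)) := by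
  have h0 : Continuous (fun x : X => tangentMap (𝓘(ℝ, ℝ).prod (𝓡 n)) (𝓡 n)
      (fun p : ℝ × X => φ p.1 p.2) ((equivTangentBundleProd 𝓘(ℝ, ℝ) ℝ (𝓡 n) X).symm
        ((⟨0, (1 : ℝ)⟩ : TangentBundle 𝓘(ℝ, ℝ) ℝ),
          zeroSection (EuclideanSpace ℝ (Fin n)) (TangentSpace (𝓡 n)) x))) := by
    refine (hφ.continuous_tangentMap le_rfl).comp
      ((contMDiff_equivTangentBundleProd_symm (n := 0)).continuous.comp ?_)
    refine continuous_const.prodMk ?_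
    exact (contMDiff_zeroSection (n := 0) ℝ (IB := 𝓡 n)
      (F := EuclideanSpace ℝ (Fin n)) (TangentSpace (𝓡 n) : X → Type _)).continuous
  convert h0 using 2 with x
  have key : ∀ (a b : X) (_ : a = b) (w : EuclideanSpace ℝ (Fin n)),
      (⟨a, w⟩ : TangentBundle (𝓡 n) X) = ⟨b, w⟩ := by rintro a b rfl w; rfl
  refine (key _ _ (φ.map_zero_apply x).symm (flowGenerator n φ x)).trans ?_
  refine congrArg (fun w : EuclideanSpace ℝ (Fin n) => (⟨φ 0 x, w⟩ : TangentBundle (𝓡 n) X)) ?_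
  have hF : MDifferentiableAt (𝓘(ℝ, ℝ).prod (𝓡 n)) (𝓡 n) (fun p : ℝ × X => φ p.1 p.2) (0, x) :=
    (ContMDiff.mdifferentiable hφ one_ne_zero) _
  have hi : MDifferentiableAt 𝓘(ℝ, ℝ) 𝓘(ℝ, ℝ) (fun t : ℝ => t) 0 := mdifferentiableAt_id
  have hc : MDifferentiableAt 𝓘(ℝ, ℝ) (𝓡 n) (fun _ : ℝ => x) 0 := mdifferentiableAt_const
  have h1 := mfderiv_comp_apply (f := fun t : ℝ => (t, x)) (0 : ℝ) hF (hi.prodMk hc) (1 : ℝ)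
  refine h1.trans ?_
  rw [mfderiv_prodMk hi hc, mfderiv_const]
  have h2 : mfderiv 𝓘(ℝ, ℝ) 𝓘(ℝ, ℝ) (fun t : ℝ => t) 0 = ContinuousLinearMap.id ℝ _ := mfderiv_id
  rw [h2]
  rfl

theorem IsFlowInvariant.flowDeriv_mem {V : ∀ x : X, Submodule ℝ (TangentSpace (𝓡 n) x)}
    (hV : IsFlowInvariant φ V) (t : ℝ) {x : X} {v : TangentSpace (𝓡 n) x} (hv : v ∈ V x) :
    flowDeriv n φ t x v ∈ V (φ t x) := by
  rw [← hV t x]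
  exact Submodule.mem_map_of_mem hv

end FlowCalculus

/-! ### Growth and decay of tangent vectors -/

section Dynamics

theorem tendsto_atBot_of_comp_neg {f : ℝ → ℝ} {l : Filter ℝ}
    (h : Tendsto (fun t => f (-t)) atTop l) : Tendsto f atBot l := by
  have h1 := h.comp tendsto_neg_atBot_atTop
  exact h1.congr fun t => congrArg f (neg_neg t)

theorem tendsto_zero_of_le_mul_pow {f : ℝ → ℝ} {C lam r : ℝ} (h0 : 0 < lam) (h1 : lam < 1)
    (hf0 : ∀ t, 0 ≤ f t) (hf : ∀ t, 0 < t → f t ≤ C * lam ^ t * r) :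
    Tendsto f atTop (𝓝 0) := by
  have h : Tendsto (fun t : ℝ => C * lam ^ t * r) atTop (𝓝 (C * 0 * r)) :=
    ((tendsto_rpow_atTop_of_base_lt_one lam (by linarith) h1).const_mul C).mul_const r
  rw [mul_zero, zero_mul] at h
  exact squeeze_zero' (Eventually.of_forall hf0) ((eventually_gt_atTop 0).mono hf) h

theorem tendsto_atTop_of_le_mul_pow {f : ℝ → ℝ} {C lam r : ℝ} (hC : 0 < C) (h0 : 0 < lam)
    (h1 : lam < 1) (hr : 0 < r) (hf : ∀ t, 0 < t → r ≤ C * lam ^ t * f t) :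
    Tendsto f atTop atTop := by
  have h : Tendsto (fun t : ℝ => lam ^ t) atTop (𝓝[>] 0) :=
    tendsto_nhdsWithin_iff.2 ⟨tendsto_rpow_atTop_of_base_lt_one lam (by linarith) h1,
      Eventually.of_forall fun t => Real.rpow_pos_of_pos h0 t⟩
  have h2 : Tendsto (fun t : ℝ => r / C * (lam ^ t)⁻¹) atTop atTop :=
    (tendsto_inv_nhdsGT_zero.comp h).const_mul_atTop (div_pos hr hC)
  refine tendsto_atTop_mono' _ ?_ h2
  filter_upwards [eventually_gt_atTop 0] with t ht
  have hp := Real.rpow_pos_of_pos h0 t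
  rw [div_mul_eq_mul_div, ← div_eq_mul_inv, div_div, div_le_iff₀ (by positivity)]
  linarith [hf t ht]

variable {n : ℕ} {X : Type*} [TopologicalSpace X] [ChartedSpace (EuclideanSpace ℝ (Fin n)) X]
  [RiemannianBundle (fun x : X => TangentSpace (𝓡 n) x)]
  {φ : Flow ℝ X} {S U : ∀ x : X, Submodule ℝ (TangentSpace (𝓡 n) x)}

theorem IsHyperbolicPair.tendsto_stable (h : IsHyperbolicPair φ S U) {x : X}
    {v : TangentSpace (𝓡 n) x} (hv : v ∈ S x) :
    Tendsto (fun t => ‖flowDeriv n φ t x v‖) atTop (𝓝 0) := by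
  obtain ⟨C, lam, hC, h0, h1, hb⟩ := h
  exact tendsto_zero_of_le_mul_pow h0 h1 (fun t => norm_nonneg _)
    fun t ht => (hb t ht x).1 v hv

theorem IsHyperbolicPair.tendsto_unstable (h : IsHyperbolicPair φ S U) {x : X}
    {v : TangentSpace (𝓡 n) x} (hv : v ∈ U x) :
    Tendsto (fun t => ‖flowDeriv n φ t x v‖) atBot (𝓝 0) := by
  obtain ⟨C, lam, hC, h0, h1, hb⟩ := h
  have := tendsto_zero_of_le_mul_pow (f := fun t => ‖flowDeriv n φ (-t) x v‖) h0 h1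
    (fun t => norm_nonneg _) fun t ht => (hb t ht x).2 v hv
  exact tendsto_atBot_of_comp_neg (f := fun t => ‖flowDeriv n φ t x v‖) this

theorem IsHyperbolicPair.tendsto_unstable_atTop (h : IsHyperbolicPair φ S U)
    (hφ : IsC1Flow n φ) (hU : IsFlowInvariant φ U) {x : X}
    {v : TangentSpace (𝓡 n) x} (hv : v ∈ U x) (hv0 : v ≠ 0) :
    Tendsto (fun t => ‖flowDeriv n φ t x v‖) atTop atTop := by
  obtain ⟨C, lam, hC, h0, h1, hb⟩ := h
  refine tendsto_atTop_of_le_mul_pow hC h0 h1 (norm_pos_iff.2 hv0) fun t ht => ?_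
  rw [← hφ.norm_flowDeriv_neg_flowDeriv t x v]
  exact (hb t ht _).2 _ (hU.flowDeriv_mem t hv)

theorem IsHyperbolicPair.tendsto_stable_atTop (h : IsHyperbolicPair φ S U)
    (hφ : IsC1Flow n φ) (hS : IsFlowInvariant φ S) {x : X}
    {v : TangentSpace (𝓡 n) x} (hv : v ∈ S x) (hv0 : v ≠ 0) :
    Tendsto (fun t => ‖flowDeriv n φ t x v‖) atBot atTop := by
  obtain ⟨C, lam, hC, h0, h1, hb⟩ := h
  have : Tendsto (fun t => ‖flowDeriv n φ (-t) x v‖) atTop atTop := by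
    refine tendsto_atTop_of_le_mul_pow hC h0 h1 (norm_pos_iff.2 hv0) fun t ht => ?_
    rw [← hφ.norm_flowDeriv_neg_flowDeriv (-t) x v]
    have key : ∀ s, s = t → ‖flowDeriv n φ s (φ (-t) x) (flowDeriv n φ (-t) x v)‖ ≤
        C * lam ^ t * ‖flowDeriv n φ (-t) x v‖ := by
      rintro _ rfl
      exact (hb _ ht _).1 _ (hS.flowDeriv_mem _ hv)
    exact key _ (neg_neg t)
  exact tendsto_atBot_of_comp_neg (f := fun t => ‖flowDeriv n φ t x v‖) this

variable [IsManifold (𝓡 n) ∞ X]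
  [IsContinuousRiemannianBundle (EuclideanSpace ℝ (Fin n))
  (fun x : X => TangentSpace (𝓡 n) x)]

theorem IsC1Flow.exists_bounds_norm_flowGenerator [CompactSpace X] (hφ : IsC1Flow n φ)
    (hZ : ∀ x, flowGenerator n φ x ≠ 0) :
    ∃ k K : ℝ, 0 < k ∧ ∀ x, k ≤ ‖flowGenerator n φ x‖ ∧ ‖flowGenerator n φ x‖ ≤ K := by
  have hc : Continuous fun x => ‖flowGenerator n φ x‖ := by
    have := (hφ.continuous_flowGenerator.inner_bundle hφ.continuous_flowGenerator).sqrt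
    simpa [real_inner_self_eq_norm_sq] using this
  rcases isEmpty_or_nonempty X with hX | hX
  · exact ⟨1, 1, one_pos, fun x => isEmptyElim x⟩
  · obtain ⟨x, -, hx⟩ := isCompact_univ.exists_isMinOn univ_nonempty hc.continuousOn
    obtain ⟨y, -, hy⟩ := isCompact_univ.exists_isMaxOn univ_nonempty hc.continuousOn
    exact ⟨_, _, norm_pos_iff.2 (hZ x), fun z => ⟨hx (mem_univ z), hy (mem_univ z)⟩⟩

/-- Along a filter of times for which `a + b • Z + c` and `a` are contracted to zero while a
nonzero `c` would be expanded without bound, only `a` survives: the component `b • Z` stays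
bounded, and bounded away from `0` unless `b = 0`. -/
theorem IsC1Flow.eq_zero_of_tendsto_norm_flowDeriv_zero [CompactSpace X] (hφ : IsC1Flow n φ)
    (hZ : ∀ x, flowGenerator n φ x ≠ 0) {l : Filter ℝ} [NeBot l] {x : X}
    {a c : TangentSpace (𝓡 n) x} {b : ℝ}
    (ha : Tendsto (fun t => ‖flowDeriv n φ t x a‖) l (𝓝 0))
    (hc : c ≠ 0 → Tendsto (fun t => ‖flowDeriv n φ t x c‖) l atTop)
    (hw : Tendsto (fun t => ‖flowDeriv n φ t x (a + b • flowGenerator n φ x + c)‖) l (𝓝 0)) :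
    b = 0 ∧ c = 0 := by
  obtain ⟨k, K, hk, hkK⟩ := hφ.exists_bounds_norm_flowGenerator hZ
  have heq : ∀ t, flowDeriv n φ t x (a + b • flowGenerator n φ x + c) = flowDeriv n φ t x a +
      b • flowGenerator n φ (φ t x) + flowDeriv n φ t x c := fun t => by
    rw [map_add, map_add, map_smul, hφ.flowDeriv_flowGenerator]
  have hsum := hw.add ha
  rw [add_zero] at hsum
  have hc0 : c = 0 := by
    by_contra h
    -- The norm of the image of `c` would be at most a sum with a finite limit.
    have hbd : Tendsto (fun t => ‖flowDeriv n φ t x (a + b • flowGenerator n φ x + c)‖ +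
        ‖flowDeriv n φ t x a‖ + |b| * K) l atTop := by
      refine tendsto_atTop_mono (fun t => ?_) (hc h)
      have h1 : flowDeriv n φ t x c = flowDeriv n φ t x (a + b • flowGenerator n φ x + c) -
          flowDeriv n φ t x a - b • flowGenerator n φ (φ t x) := by
        rw [heq]; abel
      have h2 : ‖b • flowGenerator n φ (φ t x)‖ ≤ |b| * K := by
        rw [norm_smul, Real.norm_eq_abs]
        exact mul_le_mul_of_nonneg_left (hkK _).2 (abs_nonneg b)
      rw [h1]
      exact (norm_sub_le _ _).trans (add_le_add (norm_sub_le _ _) h2)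
    exact not_tendsto_nhds_of_tendsto_atTop hbd _ (hsum.add_const (|b| * K))
  refine ⟨?_, hc0⟩
  have hle : |b| * k ≤ 0 := by
    refine ge_of_tendsto' hsum fun t => ?_
    have h1 : b • flowGenerator n φ (φ t x) =
        flowDeriv n φ t x (a + b • flowGenerator n φ x + c) - flowDeriv n φ t x a := by
      rw [heq, hc0, map_zero]; abel
    refine (mul_le_mul_of_nonneg_left (hkK (φ t x)).1 (abs_nonneg b)).trans ?_
    rw [← Real.norm_eq_abs, ← norm_smul, h1]
    exact norm_sub_le _ _
  have : |b| ≤ 0 := nonpos_of_mul_nonpos_left hle hk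
  exact abs_eq_zero.1 (le_antisymm this (abs_nonneg b))

end Dynamics

/-! ### Dynamical characterization of the stable and unstable bundles -/

section Splitting

variable {n : ℕ} {X : Type*} [TopologicalSpace X] [ChartedSpace (EuclideanSpace ℝ (Fin n)) X]
  [IsManifold (𝓡 n) ∞ X] [RiemannianBundle (fun x : X => TangentSpace (𝓡 n) x)]
  {φ : Flow ℝ X} {S U : ∀ x : X, Submodule ℝ (TangentSpace (𝓡 n) x)}

theorem IsAnosovSplitting.exists_add (h : IsAnosovSplitting φ S U) {x : X}
    (w : TangentSpace (𝓡 n) x) :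
    ∃ a ∈ S x, ∃ b : ℝ, ∃ c ∈ U x, w = a + b • flowGenerator n φ x + c := by
  have hw : w ∈ S x ⊔ Submodule.span ℝ {flowGenerator n φ x} ⊔ U x := by
    rw [h.sup_eq_top x]; trivial
  obtain ⟨y, hy, c, hc, rfl⟩ := Submodule.mem_sup.1 hw
  obtain ⟨a, ha, z, hz, rfl⟩ := Submodule.mem_sup.1 hy
  obtain ⟨b, rfl⟩ := Submodule.mem_span_singleton.1 hz
  exact ⟨a, ha, b, c, hc, rfl⟩

theorem IsAnosovSplitting.disjoint_stable (h : IsAnosovSplitting φ S U) (x : X) :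
    Disjoint (S x) (Submodule.span ℝ {flowGenerator n φ x} ⊔ U x) := by
  refine (iSupIndep_def.1 (h.independent x) 0).mono_right (sup_le ?_ ?_)
  · exact le_iSup₂_of_le 1 (by decide) le_rfl
  · exact le_iSup₂_of_le 2 (by decide) le_rfl

theorem IsAnosovSplitting.disjoint_unstable (h : IsAnosovSplitting φ S U) (x : X) :
    Disjoint (U x) (S x ⊔ Submodule.span ℝ {flowGenerator n φ x}) := by
  refine (iSupIndep_def.1 (h.independent x) 2).mono_right (sup_le ?_ ?_)
  · exact le_iSup₂_of_le 0 (by decide) le_rfl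
  · exact le_iSup₂_of_le 1 (by decide) le_rfl

theorem IsAnosovSplitting.eq_zero_of_add_eq_zero (h : IsAnosovSplitting φ S U) {x : X}
    {a c : TangentSpace (𝓡 n) x} {b : ℝ} (ha : a ∈ S x) (hc : c ∈ U x)
    (h0 : a + b • flowGenerator n φ x + c = 0) : a = 0 ∧ b = 0 ∧ c = 0 := by
  have ha0 : a = 0 := by
    refine Submodule.disjoint_def.1 (h.disjoint_stable x) a ha ?_
    have : a = -(b • flowGenerator n φ x + c) := by
      rw [add_assoc] at h0; exact eq_neg_of_add_eq_zero_left h0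
    rw [this]
    exact neg_mem (Submodule.add_mem_sup
      (Submodule.smul_mem _ b (Submodule.mem_span_singleton_self _)) hc)
  have hc0 : c = 0 := by
    refine Submodule.disjoint_def.1 (h.disjoint_unstable x) c hc ?_
    rw [eq_neg_of_add_eq_zero_right h0]
    exact neg_mem (Submodule.add_mem_sup ha
      (Submodule.smul_mem _ b (Submodule.mem_span_singleton_self _)))
  refine ⟨ha0, ?_, hc0⟩
  rw [ha0, hc0, zero_add, add_zero] at h0
  exact (smul_eq_zero.1 h0).resolve_right (h.generator_ne_zero x)

variable [IsContinuousRiemannianBundle (EuclideanSpace ℝ (Fin n))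
  (fun x : X => TangentSpace (𝓡 n) x)] [CompactSpace X]

/-- Over a compact manifold every vector that is contracted to zero in forward time is stable. -/
theorem IsAnosovSplitting.mem_stable_of_tendsto (h : IsAnosovSplitting φ S U)
    (hφ : IsC1Flow n φ) {x : X} {w : TangentSpace (𝓡 n) x}
    (hw : Tendsto (fun t => ‖flowDeriv n φ t x w‖) atTop (𝓝 0)) : w ∈ S x := by
  obtain ⟨a, ha, b, c, hc, rfl⟩ := h.exists_add w
  obtain ⟨rfl, rfl⟩ := hφ.eq_zero_of_tendsto_norm_flowDeriv_zero h.generator_ne_zero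
    (h.hyperbolic.tendsto_stable ha)
    (h.hyperbolic.tendsto_unstable_atTop hφ h.invariant_unstable hc) hw
  simpa using ha

/-- Over a compact manifold every vector that is contracted to zero in backward time is unstable. -/
theorem IsAnosovSplitting.mem_unstable_of_tendsto (h : IsAnosovSplitting φ S U)
    (hφ : IsC1Flow n φ) {x : X} {w : TangentSpace (𝓡 n) x}
    (hw : Tendsto (fun t => ‖flowDeriv n φ t x w‖) atBot (𝓝 0)) : w ∈ U x := by
  obtain ⟨a, ha, b, c, hc, rfl⟩ := h.exists_add w
  rw [add_right_comm, add_comm a, add_right_comm] at hw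
  obtain ⟨rfl, rfl⟩ := hφ.eq_zero_of_tendsto_norm_flowDeriv_zero h.generator_ne_zero
    (h.hyperbolic.tendsto_unstable hc)
    (h.hyperbolic.tendsto_stable_atTop hφ h.invariant_stable ha) hw
  simpa using hc

end Splitting

/-! ### Continuous subbundles of the tangent bundle -/

section Subbundles

variable {n : ℕ} {X : Type*} [TopologicalSpace X] [ChartedSpace (EuclideanSpace ℝ (Fin n)) X]
  [IsManifold (𝓡 n) ∞ X]

variable (n) in
/-- The trivialization of the tangent bundle around `x₀`, read in the fiber over `x`, as a
continuous linear map to the model space. -/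
abbrev tangentCoord (x₀ x : X) : TangentSpace (𝓡 n) x →L[ℝ] EuclideanSpace ℝ (Fin n) :=
  (trivializationAt (EuclideanSpace ℝ (Fin n)) (TangentSpace (𝓡 n)) x₀).continuousLinearMapAt ℝ x

variable (n) in
/-- The inverse of `tangentCoord n x₀ x`. -/
abbrev tangentCoordSymm (x₀ x : X) : EuclideanSpace ℝ (Fin n) →L[ℝ] TangentSpace (𝓡 n) x :=
  (trivializationAt (EuclideanSpace ℝ (Fin n)) (TangentSpace (𝓡 n)) x₀).symmL ℝ x

variable (n) in
/-- The domain of the trivialization of the tangent bundle around `x₀`. -/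
abbrev tangentDomain (x₀ : X) : Set X :=
  (trivializationAt (EuclideanSpace ℝ (Fin n)) (TangentSpace (𝓡 n)) x₀).baseSet

theorem isOpen_tangentDomain (x₀ : X) : IsOpen (tangentDomain n x₀) :=
  (trivializationAt (EuclideanSpace ℝ (Fin n)) (TangentSpace (𝓡 n)) x₀).open_baseSet

theorem mem_tangentDomain (x₀ : X) : x₀ ∈ tangentDomain n x₀ :=
  FiberBundle.mem_baseSet_trivializationAt' x₀

theorem tangentCoordSymm_tangentCoord {x₀ x : X} (hx : x ∈ tangentDomain n x₀)
    (v : TangentSpace (𝓡 n) x) : tangentCoordSymm n x₀ x (tangentCoord n x₀ x v) = v :=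
  Trivialization.symmL_continuousLinearMapAt _ hx v

theorem tangentCoord_tangentCoordSymm {x₀ x : X} (hx : x ∈ tangentDomain n x₀)
    (w : EuclideanSpace ℝ (Fin n)) : tangentCoord n x₀ x (tangentCoordSymm n x₀ x w) = w :=
  Trivialization.continuousLinearMapAt_symmL _ hx w

theorem continuousOn_tangentCoord {x₀ : X} {U : Set X} {v : ∀ x : X, TangentSpace (𝓡 n) x}
    (hv : ContinuousOn (fun x => (⟨x, v x⟩ : TangentBundle (𝓡 n) X)) U)
    (hU : U ⊆ tangentDomain n x₀) :
    ContinuousOn (fun x => tangentCoord n x₀ x (v x)) U := by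
  set e := trivializationAt (EuclideanSpace ℝ (Fin n)) (TangentSpace (𝓡 n)) x₀
  have h1 : ContinuousOn (fun x => (e (⟨x, v x⟩ : TangentBundle (𝓡 n) X)).2) U :=
    continuous_snd.comp_continuousOn
      (e.continuousOn.comp hv fun x hx => e.mem_source.2 (hU hx))
  refine h1.congr fun x hx => ?_
  exact e.continuousLinearMapAt_apply_of_mem (R := ℝ) (hU hx) (v x)

theorem continuousOn_tangentCoordSymm {x₀ : X} {U : Set X} {w : X → EuclideanSpace ℝ (Fin n)}
    (hw : ContinuousOn w U) (hU : U ⊆ tangentDomain n x₀) :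
    ContinuousOn (fun x => (⟨x, tangentCoordSymm n x₀ x (w x)⟩ : TangentBundle (𝓡 n) X)) U := by
  set e := trivializationAt (EuclideanSpace ℝ (Fin n)) (TangentSpace (𝓡 n)) x₀
  have h1 := e.continuousOn_symm.comp (f := fun x => (x, w x)) (s := U)
    (continuousOn_id.prodMk hw) fun x hx => ⟨hU hx, trivial⟩
  refine h1.congr fun x hx => ?_
  simp only [Function.comp_apply]
  rw [← e.symmL_apply (R := ℝ) (hU hx)]

/-- A family of subspaces is a continuous subbundle if, in the trivializations of the tangent
bundle, it is locally the image of a continuous family of projections. -/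
theorem isContinuousSubbundle_of_isProj {S : ∀ x : X, Submodule ℝ (TangentSpace (𝓡 n) x)}
    (h : ∀ x₀ : X, ∃ (U : Set X) (T : X → EuclideanSpace ℝ (Fin n) →L[ℝ] EuclideanSpace ℝ (Fin n)),
      IsOpen U ∧ x₀ ∈ U ∧ U ⊆ tangentDomain n x₀ ∧ ContinuousOn T U ∧
      ∀ x ∈ U, LinearMap.IsProj ((S x).map (tangentCoord n x₀ x).toLinearMap) (T x)) :
    IsContinuousSubbundle S := by
  intro x₀
  obtain ⟨U, T, hUo, hx₀, hU, hT, hS⟩ := h x₀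
  obtain ⟨k, W, w, hWo, hx₀W, hWU, hw, hspan⟩ := exists_frame_of_isProj hUo hx₀ hT hS
  refine ⟨k, W, fun i x => tangentCoordSymm n x₀ x (w i x), hWo, hx₀W,
    fun i => continuousOn_tangentCoordSymm (hw i) (hWU.trans hU), fun x hx => ?_⟩
  have hxd := hU (hWU hx)
  obtain ⟨hli, hs⟩ := hspan x hx
  refine ⟨?_, ?_⟩
  · refine hli.map' (tangentCoordSymm n x₀ x).toLinearMap (LinearMap.ker_eq_bot.2 ?_)
    exact Function.LeftInverse.injective (g := tangentCoord n x₀ x)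
      (tangentCoord_tangentCoordSymm hxd)
  · have h1 : (S x) = ((S x).map (tangentCoord n x₀ x).toLinearMap).map
        (tangentCoordSymm n x₀ x).toLinearMap := by
      rw [← Submodule.map_comp]
      have : (tangentCoordSymm n x₀ x).toLinearMap ∘ₗ (tangentCoord n x₀ x).toLinearMap =
          LinearMap.id := LinearMap.ext (tangentCoordSymm_tangentCoord hxd)
      rw [this, Submodule.map_id]
    rw [h1, hs, Submodule.map_span, ← range_comp]
    rfl

theorem isContinuousSubbundle_span_singleton {v : ∀ x : X, TangentSpace (𝓡 n) x}
    (hv : Continuous (fun x => (⟨x, v x⟩ : TangentBundle (𝓡 n) X))) (h0 : ∀ x, v x ≠ 0) :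
    IsContinuousSubbundle fun x => Submodule.span ℝ {v x} := fun x₀ =>
  ⟨1, univ, fun _ => v, isOpen_univ, trivial, fun _ => hv.continuousOn, fun x _ =>
    ⟨LinearIndependent.of_subsingleton 0 (h0 x), by rw [range_const]⟩⟩

theorem IsContinuousSubbundle.sup {S S' : ∀ x : X, Submodule ℝ (TangentSpace (𝓡 n) x)}
    (hS : IsContinuousSubbundle S) (hS' : IsContinuousSubbundle S')
    (hd : ∀ x, Disjoint (S x) (S' x)) : IsContinuousSubbundle fun x => S x ⊔ S' x := by
  intro x₀
  obtain ⟨k, U, v, hU, hxU, hv, hvs⟩ := hS x₀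
  obtain ⟨l, W, w, hW, hxW, hw, hws⟩ := hS' x₀
  refine ⟨k + l, U ∩ W, fun i x => Sum.elim (fun i => v i x) (fun j => w j x)
    (finSumFinEquiv.symm i), hU.inter hW, ⟨hxU, hxW⟩, fun i => ?_, fun x hx => ⟨?_, ?_⟩⟩
  · rcases h : finSumFinEquiv.symm i with i | j <;> simp only [h]
    · exact (hv i).mono inter_subset_left
    · exact (hw j).mono inter_subset_right
  · refine LinearIndependent.comp (LinearIndependent.sum_type (hvs x hx.1).1 (hws x hx.2).1 ?_) _
      finSumFinEquiv.symm.injective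
    rw [← (hvs x hx.1).2, ← (hws x hx.2).2]
    exact hd x
  · have := finSumFinEquiv.symm.surjective.range_comp
      (Sum.elim (fun i : Fin k => v i x) (fun j : Fin l => w j x))
    simp only [Function.comp_def] at this
    rw [this, Sum.elim_range, Submodule.span_union, ← (hvs x hx.1).2, ← (hws x hx.2).2]

/-- The projection onto a continuous subbundle along a continuous complement is continuous, in the
trivialization of the tangent bundle around `x₀`. -/
theorem IsContinuousSubbundle.exists_projection
    {S S' : ∀ x : X, Submodule ℝ (TangentSpace (𝓡 n) x)}
    (hS : IsContinuousSubbundle S) (hS' : IsContinuousSubbundle S')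
    (hd : ∀ x, IsCompl (S x) (S' x)) (x₀ : X) :
    ∃ (U : Set X) (P : X → EuclideanSpace ℝ (Fin n) →L[ℝ] EuclideanSpace ℝ (Fin n)),
      IsOpen U ∧ x₀ ∈ U ∧ U ⊆ tangentDomain n x₀ ∧ ContinuousOn P U ∧
      ∀ x ∈ U, (∀ a ∈ S x, P x (tangentCoord n x₀ x a) = tangentCoord n x₀ x a) ∧
        ∀ a ∈ S' x, P x (tangentCoord n x₀ x a) = 0 := by
  obtain ⟨k, U, v, hU, hxU, hv, hvs⟩ := hS x₀
  obtain ⟨l, W, w, hW, hxW, hw, hws⟩ := hS' x₀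
  set V := U ∩ W ∩ tangentDomain n x₀
  have hVd : V ⊆ tangentDomain n x₀ := inter_subset_right
  have hmap : ∀ {k : ℕ} (v : Fin k → ∀ x : X, TangentSpace (𝓡 n) x) (x : X),
      Submodule.span ℝ (range fun i => tangentCoord n x₀ x (v i x)) =
        (Submodule.span ℝ (range fun i => v i x)).map (tangentCoord n x₀ x).toLinearMap := by
    intro k v x
    rw [Submodule.map_span, ← range_comp]
    rfl
  obtain ⟨P, hPc, hP⟩ := exists_continuousOn_projection (U := V)
    (v := fun i x => tangentCoord n x₀ x (v i x)) (w := fun i x => tangentCoord n x₀ x (w i x))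
    (fun i => continuousOn_tangentCoord ((hv i).mono fun x hx => hx.1.1) hVd)
    (fun i => continuousOn_tangentCoord ((hw i).mono fun x hx => hx.1.2) hVd)
    (by
      intro x hx
      have h1 : LinearIndependent ℝ (Sum.elim (fun i => v i x) (fun j => w j x)) := by
        refine LinearIndependent.sum_type (hvs x hx.1.1).1 (hws x hx.1.2).1 ?_
        rw [← (hvs x hx.1.1).2, ← (hws x hx.1.2).2]
        exact (hd x).disjoint
      have h2 := h1.map' (tangentCoord n x₀ x).toLinearMap (LinearMap.ker_eq_bot.2
        (Function.LeftInverse.injective (g := tangentCoordSymm n x₀ x)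
          (tangentCoordSymm_tangentCoord (hVd hx))))
      have h3 : Sum.elim (fun i => tangentCoord n x₀ x (v i x))
          (fun j => tangentCoord n x₀ x (w j x)) =
          tangentCoord n x₀ x ∘ Sum.elim (fun i => v i x) (fun j => w j x) := by
        ext1 (i | j) <;> rfl
      rw [h3]
      exact h2)
    (by
      intro x hx
      rw [hmap, hmap, ← (hvs x hx.1.1).2, ← (hws x hx.1.2).2, ← Submodule.map_sup,
        (hd x).sup_eq_top, Submodule.map_top, LinearMap.range_eq_top]
      exact Function.RightInverse.surjective (g := tangentCoordSymm n x₀ x)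
        (tangentCoord_tangentCoordSymm (hVd hx)))
  refine ⟨V, P, (hU.inter hW).inter (isOpen_tangentDomain x₀), ⟨⟨hxU, hxW⟩, mem_tangentDomain x₀⟩,
    hVd, hPc, fun x hx => ⟨fun a ha => (hP x hx).1 _ ?_, fun a ha => (hP x hx).2 _ ?_⟩⟩
  · rw [hmap, ← (hvs x hx.1.1).2]
    exact Submodule.mem_map_of_mem ha
  · rw [hmap, ← (hws x hx.1.2).2]
    exact Submodule.mem_map_of_mem ha

variable {m : ℕ} {Y : Type*} [TopologicalSpace Y] [ChartedSpace (EuclideanSpace ℝ (Fin m)) Y]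
  [IsManifold (𝓡 m) ∞ Y] {f : X → Y}

/-- The derivative of a `C^1` map, in the trivializations of the tangent bundles, is continuous near
every point. -/
theorem ContMDiff.exists_continuousOn_mfderiv_coord (hf : ContMDiff (𝓡 n) (𝓡 m) 1 f) (x₀ : X) :
    ∃ U : Set X, IsOpen U ∧ x₀ ∈ U ∧ U ⊆ tangentDomain n x₀ ∧ U ⊆ f ⁻¹' tangentDomain m (f x₀) ∧
      ContinuousOn (fun x => (tangentCoord m (f x₀) (f x)).comp
        ((mfderiv (𝓡 n) (𝓡 m) f x).comp (tangentCoordSymm n x₀ x))) U := by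
  have h := (hf x₀).mfderiv_const (m := 0) (by simp)
  obtain ⟨u, hu, hc⟩ := (contMDiffAt_iff_contMDiffOn_nhds (by simp)).1 h
  refine ⟨interior u ∩ tangentDomain n x₀ ∩ f ⁻¹' tangentDomain m (f x₀),
    (isOpen_interior.inter (isOpen_tangentDomain x₀)).inter
      ((isOpen_tangentDomain _).preimage hf.continuous),
    ⟨⟨mem_interior_iff_mem_nhds.2 hu, mem_tangentDomain x₀⟩, mem_tangentDomain (f x₀)⟩,
    fun x hx => hx.1.2, fun x hx => hx.2, ?_⟩
  exact hc.continuousOn.mono fun x hx => interior_subset hx.1.1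

theorem ContMDiff.exists_isProj_ker_mfderiv (hf : ContMDiff (𝓡 n) (𝓡 m) 1 f) (x₀ : X)
    (hsurj : Function.Surjective (mfderiv (𝓡 n) (𝓡 m) f x₀)) :
    ∃ (U : Set X) (Q : X → EuclideanSpace ℝ (Fin n) →L[ℝ] EuclideanSpace ℝ (Fin n)),
      IsOpen U ∧ x₀ ∈ U ∧ U ⊆ tangentDomain n x₀ ∧ ContinuousOn Q U ∧
      ∀ x ∈ U, LinearMap.IsProj ((LinearMap.ker (mfderiv (𝓡 n) (𝓡 m) f x).toLinearMap).map
        (tangentCoord n x₀ x).toLinearMap) (Q x) := by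
  obtain ⟨U, hU, hx₀, hUn, hUm, hA⟩ := hf.exists_continuousOn_mfderiv_coord x₀
  obtain ⟨W, Q, hW, hxW, hWU, hQ, hproj⟩ := exists_isProj_ker hU hx₀ hA (by
    change Function.Surjective (tangentCoord m (f x₀) (f x₀) ∘
      (mfderiv (𝓡 n) (𝓡 m) f x₀ ∘ tangentCoordSymm n x₀ x₀))
    refine Function.Surjective.comp ?_ (hsurj.comp ?_)
    · exact Function.RightInverse.surjective (g := tangentCoordSymm m (f x₀) (f x₀))
        (tangentCoord_tangentCoordSymm (hUm hx₀))
    · exact Function.RightInverse.surjective (g := tangentCoord n x₀ x₀)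
        (tangentCoordSymm_tangentCoord (hUn hx₀)))
  refine ⟨W, Q, hW, hxW, hWU.trans hUn, hQ, fun x hx => ?_⟩
  have hxn := hUn (hWU hx)
  have hinj : Function.Injective (tangentCoord m (f x₀) (f x)) :=
    Function.LeftInverse.injective (g := tangentCoordSymm m (f x₀) (f x))
      (tangentCoordSymm_tangentCoord (hUm (hWU hx)))
  have hker : (LinearMap.ker (mfderiv (𝓡 n) (𝓡 m) f x).toLinearMap).map
      (tangentCoord n x₀ x).toLinearMap = LinearMap.ker ((tangentCoord m (f x₀) (f x)).comp
        ((mfderiv (𝓡 n) (𝓡 m) f x).comp (tangentCoordSymm n x₀ x))).toLinearMap := by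
    ext w
    constructor
    · rintro ⟨v, hv, rfl⟩
      have hv : mfderiv (𝓡 n) (𝓡 m) f x v = 0 := hv
      change tangentCoord m (f x₀) (f x) (mfderiv (𝓡 n) (𝓡 m) f x
        (tangentCoordSymm n x₀ x (tangentCoord n x₀ x v))) = 0
      rw [tangentCoordSymm_tangentCoord hxn, hv, map_zero]
    · intro hw
      refine ⟨tangentCoordSymm n x₀ x w, ?_, tangentCoord_tangentCoordSymm hxn w⟩
      exact hinj (Eq.trans hw (map_zero _).symm)
  rw [hker]
  exact hproj x hx

/-- For a `C^1` submersion `f` and a continuous splitting `TX = S ⊕ S'` that is compatible with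
`ker Df`, the intersection `S ∩ ker Df` is a continuous subbundle. If `P` is the projection onto `S`
along `S'` and `Q` a projection onto `ker Df`, then compatibility says that `P ∘ Q` is a
projection onto `S ∩ ker Df`. -/
theorem IsContinuousSubbundle.inf_ker_mfderiv
    {S S' : ∀ x : X, Submodule ℝ (TangentSpace (𝓡 n) x)}
    (hS : IsContinuousSubbundle S) (hS' : IsContinuousSubbundle S')
    (hd : ∀ x, IsCompl (S x) (S' x)) (hf : ContMDiff (𝓡 n) (𝓡 m) 1 f)
    (hsurj : ∀ x, Function.Surjective (mfderiv (𝓡 n) (𝓡 m) f x))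
    (hker : ∀ x, LinearMap.ker (mfderiv (𝓡 n) (𝓡 m) f x).toLinearMap ≤
      S x ⊓ LinearMap.ker (mfderiv (𝓡 n) (𝓡 m) f x).toLinearMap ⊔ S' x) :
    IsContinuousSubbundle fun x =>
      S x ⊓ LinearMap.ker (mfderiv (𝓡 n) (𝓡 m) f x).toLinearMap := by
  refine isContinuousSubbundle_of_isProj fun x₀ => ?_
  obtain ⟨U, P, hU, hxU, hUd, hPc, hP⟩ := hS.exists_projection hS' hd x₀
  obtain ⟨W, Q, hW, hxW, hWd, hQc, hQ⟩ := hf.exists_isProj_ker_mfderiv x₀ (hsurj x₀)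
  refine ⟨U ∩ W, fun x => (P x).comp (Q x), hU.inter hW, ⟨hxU, hxW⟩,
    inter_subset_left.trans hUd,
    (hPc.mono inter_subset_left).clm_comp (hQc.mono inter_subset_right), fun x hx => ⟨?_, ?_⟩⟩
  · intro w
    obtain ⟨v, hv, hvw⟩ := (hQ x hx.2).map_mem w
    obtain ⟨a, ha, c, hc, rfl⟩ := Submodule.mem_sup.1 (hker x hv)
    refine ⟨a, ha, ?_⟩
    change tangentCoord n x₀ x (a + c) = Q x w at hvw
    change tangentCoord n x₀ x a = P x (Q x w)
    rw [← hvw, map_add, map_add, (hP x hx.1).1 a ha.1, (hP x hx.1).2 c hc, add_zero]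
  · rintro _ ⟨a, ha, rfl⟩
    change P x (Q x (tangentCoord n x₀ x a)) = tangentCoord n x₀ x a
    have h : Q x (tangentCoord n x₀ x a) = tangentCoord n x₀ x a :=
      (hQ x hx.2).map_id _ (Submodule.mem_map_of_mem ha.2)
    rw [h]
    exact (hP x hx.1).1 a ha.1

/-- The derivative of a `C^1` map on a compact manifold is bounded. -/
theorem ContMDiff.exists_norm_mfderiv_le [CompactSpace X]
    [RiemannianBundle (fun x : X => TangentSpace (𝓡 n) x)]
    [IsContinuousRiemannianBundle (EuclideanSpace ℝ (Fin n)) (fun x : X => TangentSpace (𝓡 n) x)]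
    [RiemannianBundle (fun y : Y => TangentSpace (𝓡 m) y)]
    [IsContinuousRiemannianBundle (EuclideanSpace ℝ (Fin m)) (fun y : Y => TangentSpace (𝓡 m) y)]
    (hf : ContMDiff (𝓡 n) (𝓡 m) 1 f) :
    ∃ K : ℝ, ∀ (x : X) (v : TangentSpace (𝓡 n) x), ‖mfderiv (𝓡 n) (𝓡 m) f x v‖ ≤ K * ‖v‖ := by
  have hloc : ∀ x₀ : X, ∃ U ∈ 𝓝 x₀, ∃ K : ℝ, ∀ x ∈ U, ∀ v : TangentSpace (𝓡 n) x,
      ‖mfderiv (𝓡 n) (𝓡 m) f x v‖ ≤ K * ‖v‖ := by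
    intro x₀
    obtain ⟨U, hU, hx₀, hUn, hUm, hA⟩ := hf.exists_continuousOn_mfderiv_coord x₀
    obtain ⟨C₁, hC₁, h₁⟩ := eventually_norm_trivializationAt_lt (EuclideanSpace ℝ (Fin n))
      (fun x : X => TangentSpace (𝓡 n) x) x₀
    obtain ⟨C₂, hC₂, h₂⟩ := eventually_norm_symmL_trivializationAt_lt (EuclideanSpace ℝ (Fin m))
      (fun y : Y => TangentSpace (𝓡 m) y) (f x₀)
    obtain ⟨C₃, h₃⟩ : ∃ C₃, ∀ᶠ x in 𝓝 x₀, ‖(tangentCoord m (f x₀) (f x)).comp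
        ((mfderiv (𝓡 n) (𝓡 m) f x).comp (tangentCoordSymm n x₀ x))‖ < C₃ :=
      ⟨_, (hA.continuousAt (hU.mem_nhds hx₀)).norm.eventually_lt_const (lt_add_one _)⟩
    refine ⟨_, (((hU.eventually_mem hx₀).and h₁).and
      (hf.continuous.continuousAt.eventually h₂)).and h₃, C₂ * (C₃ * C₁), ?_⟩
    · rintro x ⟨⟨⟨hx, hx₁⟩, hx₂⟩, hx₃⟩ v
      have heq : mfderiv (𝓡 n) (𝓡 m) f x v = tangentCoordSymm m (f x₀) (f x)
          (((tangentCoord m (f x₀) (f x)).comp ((mfderiv (𝓡 n) (𝓡 m) f x).comp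
            (tangentCoordSymm n x₀ x))) (tangentCoord n x₀ x v)) := by
        simp only [ContinuousLinearMap.comp_apply]
        rw [tangentCoordSymm_tangentCoord (hUn hx), tangentCoordSymm_tangentCoord (hUm hx)]
      rw [heq, mul_assoc]
      refine ContinuousLinearMap.le_of_opNorm_le_of_le _ hx₂.le ?_
      rw [mul_assoc]
      exact ContinuousLinearMap.le_of_opNorm_le_of_le _ hx₃.le
        (ContinuousLinearMap.le_of_opNorm_le _ hx₁.le v)
  choose U hU K hK using hloc
  obtain ⟨t, ht⟩ := CompactSpace.elim_nhds_subcover U hU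
  refine ⟨∑ x ∈ t, |K x|, fun x v => ?_⟩
  have hx : x ∈ ⋃ x₀ ∈ t, U x₀ := by
    rw [ht]; trivial
  simp only [mem_iUnion] at hx
  obtain ⟨x₀, hx₀, hxU⟩ := hx
  refine (hK x₀ x hxU v).trans (mul_le_mul_of_nonneg_right ((le_abs_self _).trans ?_)
    (norm_nonneg _))
  exact Finset.single_le_sum (f := fun x => |K x|) (fun _ _ => abs_nonneg _) hx₀

end Subbundles

namespace AffineTorusBundle

/-! ### The projection of an affine torus bundle -/

section Projection

variable {m n d : ℕ} {M E : Type*}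
  [TopologicalSpace M] [ChartedSpace (EuclideanSpace ℝ (Fin m)) M]
  [TopologicalSpace E] [ChartedSpace (EuclideanSpace ℝ (Fin n)) E]

/-- The total space is covered by finitely many sets `proj⁻¹ K ≅ K × 𝕋^d` with `K` compact. -/
theorem compactSpace (B : AffineTorusBundle m n d M E) [T2Space M] [CompactSpace M] :
    CompactSpace E := by
  have hloc : ∀ x : M, ∃ K ∈ 𝓝 x, IsCompact (B.proj ⁻¹' K) := by
    intro x
    obtain ⟨e, -, hx⟩ := B.cover x
    obtain ⟨K, hK, hKb, hKc⟩ := local_compact_nhds (e.open_baseSet.mem_nhds hx)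
    refine ⟨K, hK, ?_⟩
    have hsub : K ×ˢ (univ : Set (Torus d)) ⊆ e.target := fun z hz =>
      e.mem_target.2 (hKb hz.1)
    have hc := (hKc.prod (isCompact_univ (X := Torus d))).image_of_continuousOn
      (e.toOpenPartialHomeomorph.continuousOn_symm.mono hsub)
    convert hc using 1
    ext p
    constructor
    · intro hp
      have hps : p ∈ e.source := e.mem_source.2 (hKb hp)
      refine ⟨e p, ⟨?_, trivial⟩, e.left_inv hps⟩
      rw [e.coe_fst hps]
      exact hp
    · rintro ⟨z, hz, rfl⟩
      rw [mem_preimage, e.proj_symm_apply (hsub hz)]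
      exact hz.1
  choose K hK hc using hloc
  obtain ⟨t, ht⟩ := CompactSpace.elim_nhds_subcover K hK
  refine ⟨?_⟩
  have h : (univ : Set E) = ⋃ x ∈ t, B.proj ⁻¹' K x := by
    rw [← preimage_iUnion₂, ht]
    rfl
  rw [h]
  exact t.isCompact_biUnion fun x _ => hc x

/-- The parametrization `(x, y) ↦ e⁻¹(x, [y])` of `proj⁻¹(baseSet)` by `baseSet × ℝ^d`. -/
abbrev parametrization (B : AffineTorusBundle m n d M E) (e : Trivialization (Torus d) B.proj)
    (q : M × EuclideanSpace ℝ (Fin d)) : E :=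
  e.toOpenPartialHomeomorph.symm (q.1, fun i => ((q.2 i : ℝ) : UnitAddCircle))

theorem proj_parametrization (B : AffineTorusBundle m n d M E)
    (e : Trivialization (Torus d) B.proj) {q : M × EuclideanSpace ℝ (Fin d)}
    (hq : q.1 ∈ e.baseSet) : B.proj (B.parametrization e q) = q.1 :=
  e.proj_symm_apply (e.mem_target.2 hq)

theorem exists_parametrization (B : AffineTorusBundle m n d M E) (p : E) :
    ∃ e ∈ B.atlas, ∃ q : M × EuclideanSpace ℝ (Fin d), q.1 ∈ e.baseSet ∧
      B.parametrization e q = p := by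
  obtain ⟨e, he, hp⟩ := B.cover (B.proj p)
  have hps : p ∈ e.source := e.mem_source.2 hp
  choose y hy using fun i => QuotientAddGroup.mk_surjective ((e p).2 i)
  refine ⟨e, he, (B.proj p, WithLp.toLp 2 y), hp, ?_⟩
  have h : ((B.proj p, fun i => ((WithLp.toLp 2 y i : ℝ) : UnitAddCircle)) : M × Torus d) = e p :=
    Prod.ext (e.coe_fst hps).symm (funext hy)
  exact (congrArg e.toOpenPartialHomeomorph.symm h).trans (e.left_inv hps)

theorem contMDiff_proj (B : AffineTorusBundle m n d M E) :
    ContMDiff (𝓡 n) (𝓡 m) ∞ B.proj := by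
  intro p
  obtain ⟨e, he, q, hq, rfl⟩ := B.exists_parametrization p
  have hloc : IsLocalDiffeomorphAt ((𝓡 m).prod (𝓡 d)) (𝓡 n) ∞ (B.parametrization e) q :=
    B.smooth e he ⟨q, hq, trivial⟩
  have hg := hloc.localInverse_contMDiffAt
  have hq0 : hloc.localInverse (B.parametrization e q) = q :=
    hloc.localInverse_left_inv hloc.localInverse_mem_target
  have hb : ∀ᶠ z in 𝓝 (B.parametrization e q), (hloc.localInverse z).1 ∈ e.baseSet := by
    refine (continuous_fst.continuousAt.comp hg.continuousAt).eventually_mem ?_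
    refine e.open_baseSet.mem_nhds ?_
    change (hloc.localInverse (B.parametrization e q)).1 ∈ _
    rwa [hq0]
  refine (contMDiffAt_fst.comp (B.parametrization e q) hg).congr_of_eventuallyEq ?_
  filter_upwards [hb, hloc.localInverse_eventuallyEq_right] with z hz hz'
  have hz' : B.parametrization e (hloc.localInverse z) = z := hz'
  have := B.proj_parametrization e hz
  rw [hz'] at this
  exact this

/-- In a parametrization the projection is the first factor projection `M × ℝ^d → M`. -/
theorem surjective_mfderiv_proj (B : AffineTorusBundle m n d M E) (p : E) :
    Function.Surjective (mfderiv (𝓡 n) (𝓡 m) B.proj p) := by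
  obtain ⟨e, he, q, hq, rfl⟩ := B.exists_parametrization p
  have hloc : IsLocalDiffeomorphAt ((𝓡 m).prod (𝓡 d)) (𝓡 n) ∞ (B.parametrization e) q :=
    B.smooth e he ⟨q, hq, trivial⟩
  have heq : B.proj ∘ B.parametrization e =ᶠ[𝓝 q] Prod.fst := by
    filter_upwards [(e.open_baseSet.preimage continuous_fst).mem_nhds hq] with z hz
    exact B.proj_parametrization e hz
  have h1 := mfderiv_comp q (B.contMDiff_proj.mdifferentiable (by simp) (B.parametrization e q))
    (hloc.mdifferentiableAt (by simp))
  rw [heq.mfderiv_eq, mfderiv_fst] at h1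
  intro w
  exact ⟨mfderiv ((𝓡 m).prod (𝓡 d)) (𝓡 n) (B.parametrization e) q (w, 0),
    (DFunLike.congr_fun h1 (w, 0)).symm⟩

variable {φ : Flow ℝ M} {Φ : Flow ℝ E}

/-- The identity `Dπ ∘ DΦ^t = Dφ^t ∘ Dπ`. It is stated in the model space, since the base points
`π (Φ^t p)` and `φ^t (π p)` are equal only propositionally. -/
theorem FibersOver.mfderiv_proj_flowDeriv {B : AffineTorusBundle m n d M E}
    (hfib : B.FibersOver Φ φ) (hφ : IsC1Flow m φ) (hΦ : IsC1Flow n Φ) (t : ℝ) (p : E)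
    (v : TangentSpace (𝓡 n) p) :
    @Eq (EuclideanSpace ℝ (Fin m)) (mfderiv (𝓡 n) (𝓡 m) B.proj (Φ t p) (flowDeriv n Φ t p v))
      (flowDeriv m φ t (B.proj p) (mfderiv (𝓡 n) (𝓡 m) B.proj p v)) := by
  have hπ := B.contMDiff_proj.mdifferentiable (by simp)
  have h1 := mfderiv_comp_apply p (hπ (Φ t p)) (hΦ.mdifferentiable_map t p) v
  have h2 := mfderiv_comp_apply p (hφ.mdifferentiable_map t (B.proj p)) (hπ p) v
  have h : B.proj ∘ (fun y => Φ t y) = (fun y => φ t y) ∘ B.proj := funext (hfib t)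
  rw [h] at h1
  exact h1.symm.trans h2

theorem FibersOver.mfderiv_proj_flowGenerator {B : AffineTorusBundle m n d M E}
    (hfib : B.FibersOver Φ φ) (hΦ : IsC1Flow n Φ) (p : E) :
    mfderiv (𝓡 n) (𝓡 m) B.proj p (flowGenerator n Φ p) = flowGenerator m φ (B.proj p) := by
  have h1 := mfderiv_comp_apply (0 : ℝ) (B.contMDiff_proj.mdifferentiable (by simp) (Φ 0 p))
    (hΦ.mdifferentiable_orbit p 0) (1 : ℝ)
  have h : B.proj ∘ (fun s => Φ s p) = fun s => φ s (B.proj p) := funext fun s => hfib s p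
  rw [h] at h1
  refine Eq.trans ?_ h1.symm
  exact DFunLike.congr_fun (mfderiv_congr_point (I := 𝓡 n) (I' := 𝓡 m) (f := B.proj)
    (Φ.map_zero_apply p).symm) (flowGenerator n Φ p)

theorem FibersOver.flowDeriv_mem_vertical {B : AffineTorusBundle m n d M E}
    (hfib : B.FibersOver Φ φ) (hφ : IsC1Flow m φ) (hΦ : IsC1Flow n Φ) (t : ℝ) {p : E}
    {v : TangentSpace (𝓡 n) p} (hv : v ∈ B.vertical p) :
    flowDeriv n Φ t p v ∈ B.vertical (Φ t p) := by
  have hv : mfderiv (𝓡 n) (𝓡 m) B.proj p v = 0 := hv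
  refine (hfib.mfderiv_proj_flowDeriv hφ hΦ t p v).trans ?_
  rw [hv]
  exact map_zero (flowDeriv m φ t (B.proj p))

theorem FibersOver.isFlowInvariant_inf_vertical {B : AffineTorusBundle m n d M E}
    (hfib : B.FibersOver Φ φ) (hφ : IsC1Flow m φ) (hΦ : IsC1Flow n Φ)
    {S : ∀ p : E, Submodule ℝ (TangentSpace (𝓡 n) p)} (hS : IsFlowInvariant Φ S) :
    IsFlowInvariant Φ fun p => S p ⊓ B.vertical p := by
  intro t p
  refine le_antisymm ?_ ?_
  · rintro _ ⟨v, hv, rfl⟩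
    exact ⟨hS.flowDeriv_mem t hv.1, hfib.flowDeriv_mem_vertical hφ hΦ t hv.2⟩
  · rintro w ⟨hw, hwv⟩
    have hw' := hw
    rw [← hS t p] at hw'
    obtain ⟨v, hv, rfl⟩ := hw'
    refine ⟨v, ⟨hv, ?_⟩, rfl⟩
    have h1 := (hfib.mfderiv_proj_flowDeriv hφ hΦ t p v).symm.trans hwv
    have h2 := hφ.flowDeriv_neg_flowDeriv t (B.proj p) (mfderiv (𝓡 n) (𝓡 m) B.proj p v)
    refine h2.symm.trans ?_
    refine (congrArg (flowDeriv m φ (-t) (φ t (B.proj p))) h1).trans ?_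
    exact map_zero (flowDeriv m φ (-t) (φ t (B.proj p)))

end Projection

/-! ### Splitting of the vertical bundle -/

section Decomposition

variable {m n d : ℕ} {M E : Type*}
  [TopologicalSpace M] [ChartedSpace (EuclideanSpace ℝ (Fin m)) M] [IsManifold (𝓡 m) ∞ M]
  [TopologicalSpace E] [ChartedSpace (EuclideanSpace ℝ (Fin n)) E] [IsManifold (𝓡 n) ∞ E]
  [RiemannianBundle (fun x : M => TangentSpace (𝓡 m) x)]
  [IsContinuousRiemannianBundle (EuclideanSpace ℝ (Fin m)) (fun x : M => TangentSpace (𝓡 m) x)]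
  [RiemannianBundle (fun p : E => TangentSpace (𝓡 n) p)]
  [IsContinuousRiemannianBundle (EuclideanSpace ℝ (Fin n)) (fun p : E => TangentSpace (𝓡 n) p)]
  {φ : Flow ℝ M} {Φ : Flow ℝ E} {B : AffineTorusBundle m n d M E}

theorem FibersOver.tendsto_norm_flowDeriv_mfderiv_proj [CompactSpace E]
    (hfib : B.FibersOver Φ φ) (hφ : IsC1Flow m φ) (hΦ : IsC1Flow n Φ) {l : Filter ℝ} {p : E}
    {v : TangentSpace (𝓡 n) p} (hv : Tendsto (fun t => ‖flowDeriv n Φ t p v‖) l (𝓝 0)) :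
    Tendsto (fun t => ‖flowDeriv m φ t (B.proj p) (mfderiv (𝓡 n) (𝓡 m) B.proj p v)‖) l (𝓝 0) := by
  obtain ⟨K, hK⟩ := (B.contMDiff_proj.of_le (by simp : (1 : ℕ∞ω) ≤ ∞)).exists_norm_mfderiv_le
  have h := hv.const_mul K
  rw [mul_zero] at h
  refine squeeze_zero (fun t => norm_nonneg _) (fun t => ?_) h
  refine le_trans (le_of_eq ?_) (hK (Φ t p) (flowDeriv n Φ t p v))
  refine Eq.trans ?_ (norm_tangent_congr (hfib t p).symm
    (mfderiv (𝓡 n) (𝓡 m) B.proj (Φ t p) (flowDeriv n Φ t p v)))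
  exact congrArg (fun w : TangentSpace (𝓡 m) (φ t (B.proj p)) => ‖w‖)
    (hfib.mfderiv_proj_flowDeriv hφ hΦ t p v).symm

/-- The vertical bundle is spanned by its stable and unstable parts. The three components of
`Dπ v = 0` along an Anosov splitting of `TE` lie in the respective summands of the Anosov splitting
of `TM`, because `Dπ` is bounded and intertwines the flows; hence each of them vanishes. -/
theorem vertical_le_sup [CompactSpace M] [CompactSpace E]
    {S U : ∀ x : M, Submodule ℝ (TangentSpace (𝓡 m) x)}
    {Es Eu : ∀ p : E, Submodule ℝ (TangentSpace (𝓡 n) p)}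
    (hfib : B.FibersOver Φ φ) (hφ : IsC1Flow m φ) (hΦ : IsC1Flow n Φ)
    (hSU : IsAnosovSplitting φ S U) (hE : IsAnosovSplitting Φ Es Eu) (p : E) :
    B.vertical p ≤ (Es p ⊓ B.vertical p) ⊔ (Eu p ⊓ B.vertical p) := by
  intro v hv
  have hv : mfderiv (𝓡 n) (𝓡 m) B.proj p v = 0 := hv
  obtain ⟨a, ha, b, c, hc, rfl⟩ := hE.exists_add v
  rw [map_add, map_add, map_smul, hfib.mfderiv_proj_flowGenerator hΦ] at hv
  obtain ⟨ha0, rfl, hc0⟩ := hSU.eq_zero_of_add_eq_zero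
    (hSU.mem_stable_of_tendsto hφ (hfib.tendsto_norm_flowDeriv_mfderiv_proj hφ hΦ
      (hE.hyperbolic.tendsto_stable ha)))
    (hSU.mem_unstable_of_tendsto hφ (hfib.tendsto_norm_flowDeriv_mfderiv_proj hφ hΦ
      (hE.hyperbolic.tendsto_unstable hc))) hv
  rw [zero_smul, add_zero]
  exact Submodule.add_mem_sup ⟨ha, ha0⟩ ⟨hc, hc0⟩

theorem isFiberwiseAnosovSplitting [CompactSpace M] [CompactSpace E]
    {S U : ∀ x : M, Submodule ℝ (TangentSpace (𝓡 m) x)}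
    {Es Eu : ∀ p : E, Submodule ℝ (TangentSpace (𝓡 n) p)}
    (hfib : B.FibersOver Φ φ) (hφ : IsC1Flow m φ) (hΦ : IsC1Flow n Φ)
    (hSU : IsAnosovSplitting φ S U) (hE : IsAnosovSplitting Φ Es Eu) :
    B.IsFiberwiseAnosovSplitting Φ
      (fun p => Es p ⊓ B.vertical p) (fun p => Eu p ⊓ B.vertical p) := by
  have hle := vertical_le_sup hfib hφ hΦ hSU hE
  have hπ := B.contMDiff_proj.of_le (by simp : (1 : ℕ∞ω) ≤ ∞)
  have hZ := isContinuousSubbundle_span_singleton hΦ.continuous_flowGenerator hE.generator_ne_zero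
  have hZU : IsContinuousSubbundle fun p => Submodule.span ℝ {flowGenerator n Φ p} ⊔ Eu p :=
    hZ.sup hE.continuous_unstable fun p =>
      ((hE.disjoint_unstable p).mono_right le_sup_right).symm
  have hSZ : IsContinuousSubbundle fun p => Es p ⊔ Submodule.span ℝ {flowGenerator n Φ p} :=
    hE.continuous_stable.sup hZ fun p => (hE.disjoint_stable p).mono_right le_sup_left
  have hcs : ∀ p, IsCompl (Es p) (Submodule.span ℝ {flowGenerator n Φ p} ⊔ Eu p) := fun p =>
    ⟨hE.disjoint_stable p, codisjoint_iff.2 (by rw [← sup_assoc]; exact hE.sup_eq_top p)⟩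
  have hcu : ∀ p, IsCompl (Eu p) (Es p ⊔ Submodule.span ℝ {flowGenerator n Φ p}) := fun p =>
    ⟨hE.disjoint_unstable p, codisjoint_iff.2 (by rw [sup_comm]; exact hE.sup_eq_top p)⟩
  obtain ⟨C, lam, hC, h0, h1, hb⟩ := hE.hyperbolic
  exact
    { continuous_stable := hE.continuous_stable.inf_ker_mfderiv hZU hcs hπ
        B.surjective_mfderiv_proj fun p =>
          (hle p).trans (sup_le_sup_left (inf_le_left.trans le_sup_right) _)
      continuous_unstable := hE.continuous_unstable.inf_ker_mfderiv hSZ hcu hπ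
        B.surjective_mfderiv_proj fun p =>
          (hle p).trans (sup_le (le_sup_of_le_right (inf_le_left.trans le_sup_left)) le_sup_left)
      disjoint := fun p => (hE.disjoint_stable p).mono inf_le_left (inf_le_left.trans le_sup_right)
      sup_eq_vertical := fun p => le_antisymm (sup_le inf_le_right inf_le_right) (hle p)
      invariant_stable := hfib.isFlowInvariant_inf_vertical hφ hΦ hE.invariant_stable
      invariant_unstable := hfib.isFlowInvariant_inf_vertical hφ hΦ hE.invariant_unstable
      hyperbolic := ⟨C, lam, hC, h0, h1, fun t ht p =>
        ⟨fun v hv => (hb t ht p).1 v hv.1, fun v hv => (hb t ht p).2 v hv.1⟩⟩ }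

end Decomposition

end AffineTorusBundle

end

theorem proposition2p5 {m n d : ℕ} {M E : Type*}
    [TopologicalSpace M] [T2Space M] [CompactSpace M]
    [ChartedSpace (EuclideanSpace ℝ (Fin m)) M] [IsManifold (𝓡 m) ∞ M]
    [TopologicalSpace E] [ChartedSpace (EuclideanSpace ℝ (Fin n)) E] [IsManifold (𝓡 n) ∞ E]
    [RiemannianBundle (fun x : M => TangentSpace (𝓡 m) x)]
    [IsContinuousRiemannianBundle (EuclideanSpace ℝ (Fin m)) (fun x : M => TangentSpace (𝓡 m) x)]
    [RiemannianBundle (fun p : E => TangentSpace (𝓡 n) p)]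
    [IsContinuousRiemannianBundle (EuclideanSpace ℝ (Fin n)) (fun p : E => TangentSpace (𝓡 n) p)]
    (B : AffineTorusBundle m n d M E) (φ : Flow ℝ M) (Φ : Flow ℝ E)
    (hφ : IsAnosovFlow m φ) (hfib : B.FibersOver Φ φ) (hΦ : IsAnosovFlow n Φ) :
    B.IsFiberwiseAnosovFlow Φ φ ∧
    (B.IsFiberwiseAffine Φ φ → B.IsFiberwiseAffineAnosovFlow Φ φ) ∧
    ∀ Es Eu : ∀ p : E, Submodule ℝ (TangentSpace (𝓡 n) p), IsAnosovSplitting Φ Es Eu →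
      B.IsFiberwiseAnosovSplitting Φ
        (fun p => Es p ⊓ B.vertical p) (fun p => Eu p ⊓ B.vertical p) := by
  have : CompactSpace E := B.compactSpace
  obtain ⟨hφ1, S, U, hSU⟩ := hφ
  obtain ⟨hΦ1, Es₀, Eu₀, hE₀⟩ := hΦ
  have hA : B.IsFiberwiseAnosovFlow Φ φ :=
    ⟨hΦ1, hfib, _, _, AffineTorusBundle.isFiberwiseAnosovSplitting hfib hφ1 hΦ1 hSU hE₀⟩
  exact ⟨hA, fun haff => ⟨hA, haff⟩, fun Es Eu hE =>
    AffineTorusBundle.isFiberwiseAnosovSplitting hfib hφ1 hΦ1 hSU hE⟩
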